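/- **Definitions.** For a finite simple graph $\mathcal G$ with vertices $v_1,\dots,v_N$, let $CN(\mathcal G)$ be the $N\times N$ matrix whose $(i,j)$ entry is the number of common neighbours of $v_i$ and $v_j$ if $i\neq j$, and $0$ if $i=j$. Let $CNRS(\mathcal G)$ be the diagonal matrix of the row sums of $CN(\mathcal G)$, and put $CNL(\mathcal G)=CNRS(\mathcal G)-CN(\mathcal G)$ and $CNSL(\mathcal G)=CNRS(\mathcal G)+CN(\mathcal G)$. The CNL-spectrum and the CNSL-spectrum of $\mathcal G$ are the multisets of eigenvalues (with multiplicities) of $CNL(\mathcal G)$ and $CNSL(\mathcal G)$; $(\alpha)^a$ means that $\alpha$ is listed $a$ times (the listed values need not be distinct, multiplicities of coinciding values being added, and $a=0$ is allowed). With $\Delta(\mathcal G)=\operatorname{tr}(CNRS(\mathcal G))/N$, the energies $LE_{CN}(\mathcal G)$ and $LE^+_{CN}(\mathcal G)$ are $\sum|\alpha-\Delta(\mathcal G)|$, the sum being over the CNL-spectrum, respectively the CNSL-spectrum, with multiplicities. For a finite non-abelian group $G$, the commuting conjugacy class graph $\Gamma_G$ has as vertices the conjugacy classes of non-central elements of $G$,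 and two distinct classes are adjacent if some element of the one commutes with some element of the other. $K_m$ is the complete graph on $m$ vertices, $\cup$ is disjoint union, and $2K_m=K_m\cup K_m$. $D_{2n}$ is the dihedral group of order $2n$. **Theorem.** Let $G$ be a finite group with $|Z(G)|=z$ and $G/Z(G)\cong D_{2n}$, where $n\ge 3$. (a) If $n$ is even, then $z$ is even, $\Gamma_G\cong K_{(n-1)z/2}\cup 2K_{z/2}$, and (i) the CNL-spectrum of $\Gamma_G$ is $$\left\{(0)^3,\ \left(\tfrac14(nz-z)(nz-z-4)\right)^{\frac12(nz-z-2)},\ \left(\tfrac14z(z-4)\right)^{z-2}\right\},$$ and $$LE_{CN}(\Gamma_G)=\frac{((n-1)z-2)\,\bigl(n(z+1)((n-2)z-4)+11z-4\bigr)}{2(n+1)};$$ (ii) the CNSL-spectrum of $\Gamma_G$ is $$\left\{\left(\tfrac12(nz-z-2)(nz-z-4)\right)^1,\ \left(\tfrac14(nz-z-4)^2\right)^{\frac12(nz-z-2)},\ \left(\tfrac12(z-2)(z-4)\right)^2,\ \left(\tfrac14(z-4)^2\right)^{z-2}\right\},$$ and $$LE^+_{CN}(\Gamma_G)=\begin{cases}\frac{28}{5},&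 n=4,\ z=2,\\[2pt] \frac35z^2(4z-6),& n=4,\ z\ge3,\\[2pt] \frac{(n-2)(n-1)z^2(nz-6)}{2(n+1)},&\text{otherwise.}\end{cases}$$ (b) If $n$ is odd, then $\Gamma_G\cong K_{(n-1)z/2}\cup K_z$, and (i) the CNL-spectrum of $\Gamma_G$ is $$\left\{(0)^2,\ \left(\tfrac14(nz-z)(nz-z-4)\right)^{\frac12(nz-z-2)},\ \left(z(z-2)\right)^{z-1}\right\},$$ and $$LE_{CN}(\Gamma_G)=\begin{cases}0,& n=3,\ z=1,\\[2pt] 4(z-1)(z-2),& n=3,\ z\ge2,\\[2pt] \frac{((n-1)z-2)\left((n-3)(n+1)z^2+((n-6)n+17)z-4(n+1)\right)}{2(n+1)},&\text{otherwise;}\end{cases}$$ (ii) the CNSL-spectrum of $\Gamma_G$ is $$\left\{\left(\tfrac12(nz-z-2)(nz-z-4)\right)^1,\ \left(\tfrac14(nz-z-4)^2\right)^{\frac12(nz-z-2)},\ \left(2(z-1)(z-2)\right)^1,\ \left((z-2)^2\right)^{z-1}\right\},$$ and $$LE^+_{CN}(\Gamma_G)=\begin{cases}0,& n=3,\ z=1\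 \text{ or }\ n=5,\ z=1,\\[2pt] 4(z-1)(z-2),& n=3,\ z\ge2,\\[2pt] \frac{(n-5)(n-3)(n+3)}{2(n+1)},& n\ge7,\ z=1,\\[2pt] \frac{(n-3)(n-1)z^2(nz+z-6)}{2(n+1)},&\text{otherwise.}\end{cases}$$ -/

import Mathlib

/-- The number of common neighbours of each pair of distinct vertices; zero on the diagonal. -/
noncomputable def cnMatrix {V : Type*} [DecidableEq V] (Γ : SimpleGraph V) : Matrix V V ℝ :=
  Matrix.of fun v w => if v = w then 0 else ((Γ.commonNeighbors v w).ncard : ℝ)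

/-- The diagonal matrix of the row sums of `cnMatrix`. -/
noncomputable def cnRowSumMatrix {V : Type*} [Fintype V] [DecidableEq V] (Γ : SimpleGraph V) :
    Matrix V V ℝ :=
  Matrix.diagonal fun v => ∑ w, cnMatrix Γ v w

/-- The common neighborhood Laplacian matrix. -/
noncomputable def cnlMatrix {V : Type*} [Fintype V] [DecidableEq V] (Γ : SimpleGraph V) :
    Matrix V V ℝ :=
  cnRowSumMatrix Γ - cnMatrix Γ

/-- The common neighborhood signless Laplacian matrix. -/
noncomputable def cnslMatrix {V : Type*} [Fintype V] [DecidableEq V] (Γ : SimpleGraph V) :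
    Matrix V V ℝ :=
  cnRowSumMatrix Γ + cnMatrix Γ

/-- The eigenvalues of the common neighborhood Laplacian matrix, with multiplicities. The matrix
is real symmetric, so its characteristic polynomial has all its roots in `ℝ`. -/
noncomputable def cnlSpec {V : Type*} [Fintype V] [DecidableEq V] (Γ : SimpleGraph V) :
    Multiset ℝ :=
  (cnlMatrix Γ).charpoly.roots

/-- The eigenvalues of the common neighborhood signless Laplacian matrix, with multiplicities. -/
noncomputable def cnslSpec {V : Type*} [Fintype V] [DecidableEq V] (Γ : SimpleGraph V) :
    Multiset ℝ :=
  (cnslMatrix Γ).charpoly.roots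

/-- The trace of the row-sum matrix divided by the number of vertices. -/
noncomputable def cnDelta {V : Type*} [Fintype V] [DecidableEq V] (Γ : SimpleGraph V) : ℝ :=
  (cnRowSumMatrix Γ).trace / (Fintype.card V : ℝ)

/-- The common neighborhood Laplacian energy. -/
noncomputable def cnlEnergy {V : Type*} [Fintype V] [DecidableEq V] (Γ : SimpleGraph V) : ℝ :=
  ((cnlSpec Γ).map fun α => |α - cnDelta Γ|).sum

/-- The common neighborhood signless Laplacian energy. -/
noncomputable def cnslEnergy {V : Type*} [Fintype V] [DecidableEq V] (Γ : SimpleGraph V) : ℝ :=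
  ((cnslSpec Γ).map fun β => |β - cnDelta Γ|).sum

/-- The conjugacy classes of the non-central elements of `G`. -/
def CCCVertex (G : Type*) [Group G] : Type _ :=
  {c : ConjClasses G // ∃ x : G, x ∉ Subgroup.center G ∧ ConjClasses.mk x = c}

noncomputable instance CCCVertex.instFintype (G : Type*) [Group G] [Finite G] :
    Fintype (CCCVertex G) :=
  haveI : Finite (ConjClasses G) := Quotient.finite _
  haveI : Finite (CCCVertex G) := Subtype.finite
  Fintype.ofFinite _

noncomputable instance CCCVertex.instDecidableEq (G : Type*) [Group G] :
    DecidableEq (CCCVertex G) :=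
  Classical.decEq _

/-- The commuting conjugacy class graph: distinct non-central classes are adjacent when they
contain commuting representatives. -/
def cccGraph (G : Type*) [Group G] : SimpleGraph (CCCVertex G) where
  Adj c d := c ≠ d ∧ ∃ x ∈ c.1.carrier, ∃ y ∈ d.1.carrier, Commute x y
  symm := ⟨fun _ _ h => ⟨h.1.symm, by
    obtain ⟨x, hx, y, hy, hxy⟩ := h.2
    exact ⟨y, hy, x, hx, hxy.symm⟩⟩⟩
  loopless := ⟨fun _ h => h.1 rfl⟩


/-!
The rotations of `D_{2n}` form a cyclic subgroup of index two, so their preimage in `G` is an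
abelian subgroup `A` of index two. A non-central element of `A` commutes with nothing outside `A`,
and two commuting elements outside `A` differ by a central element. Hence the non-central classes
inside `A` form one clique of the graph, and the classes outside `A` form one clique for each
conjugacy class of reflections in `D_{2n}`. The classes inside `A` have size `2` and those outside
have size `n`, which gives the sizes of the cliques.

The spectrum of a disjoint union of cliques is explicit. The spectrum has mean `Δ`, so
the deviations from `Δ` cancel and the energy is twice the total excess over `Δ`; it only remains
to decide which of the few distinct eigenvalues exceed `Δ`.
-/

section MeanAbsoluteDeviation

variable {α : Type*} [AddCommGroup α] [LinearOrder α] [IsOrderedAddMonoid α]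

theorem sum_map_abs_sub_of_le_of_le {s t : Multiset α} {d : α} (hs : ∀ x ∈ s, d ≤ x)
    (ht : ∀ x ∈ t, x ≤ d) (hd : (s + t).sum = (s + t).card • d) :
    ((s + t).map fun x => |x - d|).sum = 2 • (s.map fun x => x - d).sum := by
  have above : (s.map fun x => |x - d|) = s.map fun x => x - d :=
    Multiset.map_congr rfl fun x hx => abs_of_nonneg (sub_nonneg.2 (hs x hx))
  have below : (t.map fun x => |x - d|) = t.map fun x => -(x - d) :=
    Multiset.map_congr rfl fun x hx => abs_of_nonpos (sub_nonpos.2 (ht x hx))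
  have balance : (s.map fun x => x - d).sum + (t.map fun x => x - d).sum = 0 := by
    rw [← Multiset.sum_add, ← Multiset.map_add, Multiset.sum_map_sub, Multiset.map_id',
      Multiset.map_const', Multiset.sum_replicate, hd, sub_self]
  rw [Multiset.map_add, Multiset.sum_add, above, below, Multiset.sum_map_neg,
    ← eq_neg_of_add_eq_zero_left balance, two_nsmul]

end MeanAbsoluteDeviation

section Pencil

variable {V W : Type*} [DecidableEq V] [DecidableEq W]

theorem cnMatrix_isSymm (Γ : SimpleGraph V) : (cnMatrix Γ).IsSymm :=
  Matrix.IsSymm.ext fun v w => by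
    simp only [cnMatrix, Matrix.of_apply, eq_comm, SimpleGraph.commonNeighbors_symm]

theorem cnMatrix_apply_iso {Γ : SimpleGraph V} {Δ : SimpleGraph W} (e : Γ ≃g Δ) (v w : V) :
    cnMatrix Δ (e v) (e w) = cnMatrix Γ v w := by
  have h : Δ.commonNeighbors (e v) (e w) = e '' Γ.commonNeighbors v w := by
    ext x
    obtain ⟨x, rfl⟩ := e.surjective x
    simp [SimpleGraph.commonNeighbors, e.map_adj_iff]
  simp [cnMatrix, h, Set.ncard_image_of_injective _ e.injective]

theorem cnMatrix_sum (Γ : SimpleGraph V) (Δ : SimpleGraph W) :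
    cnMatrix (Γ ⊕g Δ) = Matrix.fromBlocks (cnMatrix Γ) 0 0 (cnMatrix Δ) := by
  have inl_inl (v w : V) : (Γ ⊕g Δ).commonNeighbors (.inl v) (.inl w) =
      Sum.inl '' Γ.commonNeighbors v w := by
    ext (x | x) <;> simp [SimpleGraph.commonNeighbors]
  have inr_inr (v w : W) : (Γ ⊕g Δ).commonNeighbors (.inr v) (.inr w) =
      Sum.inr '' Δ.commonNeighbors v w := by
    ext (x | x) <;> simp [SimpleGraph.commonNeighbors]
  have inl_inr (v : V) (w : W) : (Γ ⊕g Δ).commonNeighbors (.inl v) (.inr w) = ∅ := by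
    ext (x | x) <;> simp [SimpleGraph.commonNeighbors]
  ext (v | v) (w | w)
  · simp [cnMatrix, inl_inl, Set.ncard_image_of_injective _ Sum.inl_injective]
  · simp [cnMatrix, inl_inr]
  · simp [cnMatrix, SimpleGraph.commonNeighbors_symm, inl_inr]
  · simp [cnMatrix, inr_inr, Set.ncard_image_of_injective _ Sum.inr_injective]

variable [Fintype V] [Fintype W]

/-- The matrix pencil `CNRS(Γ) + c • CN(Γ)`. The values `c = -1` and `c = 1` are the common
neighborhood Laplacian and signless Laplacian, so that both can be treated at once. -/
noncomputable def cnPencil (Γ : SimpleGraph V) (c : ℝ) : Matrix V V ℝ :=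
  cnRowSumMatrix Γ + c • cnMatrix Γ

/-- The eigenvalues of `cnPencil Γ c`, with multiplicities. -/
noncomputable def cnPencilSpec (Γ : SimpleGraph V) (c : ℝ) : Multiset ℝ :=
  (cnPencil Γ c).charpoly.roots

theorem cnlSpec_eq_cnPencilSpec (Γ : SimpleGraph V) : cnlSpec Γ = cnPencilSpec Γ (-1) := by
  rw [cnlSpec, cnPencilSpec, cnlMatrix, cnPencil, neg_one_smul, sub_eq_add_neg]

theorem cnslSpec_eq_cnPencilSpec (Γ : SimpleGraph V) : cnslSpec Γ = cnPencilSpec Γ 1 := by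
  rw [cnslSpec, cnPencilSpec, cnslMatrix, cnPencil, one_smul]

theorem cnPencil_isHermitian (Γ : SimpleGraph V) (c : ℝ) : (cnPencil Γ c).IsHermitian := by
  rw [Matrix.IsHermitian, Matrix.conjTranspose_eq_transpose_of_trivial]
  exact (Matrix.isSymm_diagonal _).add ((cnMatrix_isSymm Γ).smul c)

theorem card_cnPencilSpec (Γ : SimpleGraph V) (c : ℝ) :
    (cnPencilSpec Γ c).card = Fintype.card V := by
  rw [cnPencilSpec, ← (cnPencil_isHermitian Γ c).splits_charpoly.natDegree_eq_card_roots,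
    Matrix.charpoly_natDegree_eq_dim]

theorem sum_cnPencilSpec (Γ : SimpleGraph V) (c : ℝ) :
    (cnPencilSpec Γ c).sum = Fintype.card V * cnDelta Γ := by
  have trace_cnMatrix : (cnMatrix Γ).trace = 0 := by simp [Matrix.trace, cnMatrix]
  have trace_eq : (cnPencilSpec Γ c).sum = (cnRowSumMatrix Γ).trace := by
    rw [cnPencilSpec, ← Matrix.trace_eq_sum_roots_charpoly_of_splits
      (cnPencil_isHermitian Γ c).splits_charpoly, cnPencil, Matrix.trace_add, Matrix.trace_smul,
      trace_cnMatrix, smul_zero, add_zero]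
  rcases isEmpty_or_nonempty V with hV | hV
  · simp [trace_eq, Matrix.trace]
  · rw [trace_eq, cnDelta, mul_div_cancel₀ _ (Nat.cast_ne_zero.2 Fintype.card_ne_zero)]

theorem sum_abs_sub_cnDelta {Γ : SimpleGraph V} {c : ℝ} {s t : Multiset ℝ}
    (h : cnPencilSpec Γ c = s + t) (hs : ∀ x ∈ s, cnDelta Γ ≤ x) (ht : ∀ x ∈ t, x ≤ cnDelta Γ) :
    ((cnPencilSpec Γ c).map fun x => |x - cnDelta Γ|).sum =
      2 * (s.map fun x => x - cnDelta Γ).sum := by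
  have mean_eq : (s + t).sum = (s + t).card • cnDelta Γ := by
    rw [← h, sum_cnPencilSpec, card_cnPencilSpec, nsmul_eq_mul]
  rw [h, sum_map_abs_sub_of_le_of_le hs ht mean_eq, nsmul_eq_mul, Nat.cast_ofNat]

theorem cnPencil_apply_iso {Γ : SimpleGraph V} {Δ : SimpleGraph W} (e : Γ ≃g Δ) (c : ℝ) (v w : V) :
    cnPencil Δ c (e v) (e w) = cnPencil Γ c v w := by
  have row_sum : ∑ u, cnMatrix Δ (e v) u = ∑ u, cnMatrix Γ v u :=
    (Fintype.sum_equiv e.toEquiv _ _ fun u => (cnMatrix_apply_iso e v u).symm).symm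
  simp [cnPencil, cnRowSumMatrix, Matrix.diagonal_apply, cnMatrix_apply_iso, row_sum]

theorem cnPencilSpec_congr {Γ : SimpleGraph V} {Δ : SimpleGraph W} (e : Γ ≃g Δ) (c : ℝ) :
    cnPencilSpec Γ c = cnPencilSpec Δ c := by
  have h : cnPencil Γ c = Matrix.reindex e.symm.toEquiv e.symm.toEquiv (cnPencil Δ c) :=
    Matrix.ext fun v w => (cnPencil_apply_iso e c v w).symm
  rw [cnPencilSpec, h, Matrix.charpoly_reindex, cnPencilSpec]

theorem cnPencil_sum (Γ : SimpleGraph V) (Δ : SimpleGraph W) (c : ℝ) :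
    cnPencil (Γ ⊕g Δ) c = Matrix.fromBlocks (cnPencil Γ c) 0 0 (cnPencil Δ c) := by
  have row_sums : cnRowSumMatrix (Γ ⊕g Δ) =
      Matrix.fromBlocks (cnRowSumMatrix Γ) 0 0 (cnRowSumMatrix Δ) := by
    rw [cnRowSumMatrix, cnRowSumMatrix, cnRowSumMatrix, Matrix.fromBlocks_diagonal, cnMatrix_sum]
    congr 1
    ext (v | v) <;> simp
  simp [cnPencil, row_sums, cnMatrix_sum, Matrix.fromBlocks_smul, Matrix.fromBlocks_add]

theorem cnPencilSpec_sum (Γ : SimpleGraph V) (Δ : SimpleGraph W) (c : ℝ) :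
    cnPencilSpec (Γ ⊕g Δ) c = cnPencilSpec Γ c + cnPencilSpec Δ c := by
  rw [cnPencilSpec, cnPencil_sum, Matrix.charpoly_fromBlocks_zero₁₂, Polynomial.roots_mul
    ((Matrix.charpoly_monic _).mul (Matrix.charpoly_monic _)).ne_zero, cnPencilSpec, cnPencilSpec]

end Pencil

section CompleteGraph

open Polynomial in
theorem charpoly_scalar_add_const {ι R : Type*} [Fintype ι] [DecidableEq ι] [Nonempty ι]
    [CommRing R] (a b : R) :
    (Matrix.scalar ι a + Matrix.of fun _ _ : ι => b).charpoly =
      (X - C (a + Fintype.card ι * b)) * (X - C a) ^ (Fintype.card ι - 1) := by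
  have rank_one : Matrix.scalar ι a + Matrix.of (fun _ _ : ι => b) =
      Matrix.vecMulVec (fun _ => b) (fun _ => 1) - Matrix.scalar ι (-a) := by
    ext i j
    rw [Matrix.add_apply, Matrix.sub_apply, Matrix.scalar_apply, Matrix.scalar_apply,
      Matrix.diagonal_apply, Matrix.diagonal_apply, Matrix.of_apply, Matrix.vecMulVec_apply]
    split_ifs <;> simp [add_comm]
  obtain ⟨k, hk⟩ : ∃ k, Fintype.card ι = k + 1 :=
    Nat.exists_eq_succ_of_ne_zero Fintype.card_ne_zero
  rw [rank_one, Matrix.charpoly_sub_scalar, Matrix.charpoly_vecMulVec]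
  simp only [hk, pow_succ, dotProduct, mul_one, Finset.sum_const, Finset.card_univ, nsmul_eq_mul,
    Nat.cast_add, Nat.cast_one, add_tsub_cancel_right, smul_eq_C_mul, map_mul, map_add,
    map_natCast, map_one, map_neg, sub_comp, mul_comp, pow_comp, X_comp, add_comp, natCast_comp,
    one_comp, C_comp]
  ring

variable {V : Type*} [Fintype V] [DecidableEq V]

theorem cnMatrix_completeGraph (v w : V) :
    cnMatrix (SimpleGraph.completeGraph V) v w = if v = w then 0 else (Fintype.card V : ℝ) - 2 := by
  rw [cnMatrix, Matrix.of_apply]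
  split_ifs with h
  · rfl
  · have two_le : 2 ≤ Fintype.card V := by
      simpa [Finset.card_pair h] using Finset.card_le_univ {v, w}
    rw [SimpleGraph.completeGraph_eq_top, SimpleGraph.commonNeighbors_top_eq,
      Set.ncard_sdiff (Set.subset_univ _), Set.ncard_univ, Set.ncard_pair h,
      Nat.card_eq_fintype_card, Nat.cast_sub two_le, Nat.cast_ofNat]

theorem sum_cnMatrix_completeGraph (v : V) :
    ∑ w, cnMatrix (SimpleGraph.completeGraph V) v w =
      ((Fintype.card V : ℝ) - 1) * (Fintype.card V - 2) := by
  simp [cnMatrix_completeGraph, Finset.sum_ite, Finset.filter_ne, Finset.card_erase_of_mem,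
    Nat.cast_sub (Fintype.card_pos_iff.2 ⟨v⟩), mul_sub]

theorem cnPencilSpec_completeGraph [Nonempty V] (c : ℝ) :
    cnPencilSpec (SimpleGraph.completeGraph V) c =
      {(1 + c) * ((Fintype.card V : ℝ) - 1) * (Fintype.card V - 2)} +
        Multiset.replicate (Fintype.card V - 1)
          (((Fintype.card V : ℝ) - 2) * (Fintype.card V - 1 - c)) := by
  set m : ℝ := (Fintype.card V : ℝ) with hm
  have h : cnPencil (SimpleGraph.completeGraph V) c =
      Matrix.scalar V ((m - 2) * (m - 1 - c)) + Matrix.of fun _ _ => c * (m - 2) := by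
    ext v w
    rw [cnPencil, cnRowSumMatrix, Matrix.add_apply, Matrix.smul_apply, Matrix.diagonal_apply,
      sum_cnMatrix_completeGraph, cnMatrix_completeGraph, Matrix.add_apply, Matrix.scalar_apply,
      Matrix.diagonal_apply, Matrix.of_apply, smul_eq_mul, ← hm]
    split_ifs <;> ring
  have top_eigenvalue :
      (m - 2) * (m - 1 - c) + m * (c * (m - 2)) = (1 + c) * (m - 1) * (m - 2) := by
    ring
  rw [cnPencilSpec, h, charpoly_scalar_add_const, ← hm, top_eigenvalue,
    Polynomial.roots_mul (mul_ne_zero (Polynomial.X_sub_C_ne_zero _)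
      (pow_ne_zero _ (Polynomial.X_sub_C_ne_zero _))),
    Polynomial.roots_pow, Polynomial.roots_X_sub_C, Polynomial.roots_X_sub_C,
    Multiset.nsmul_singleton]

end CompleteGraph

section CliqueUnion

theorem sub_one_mul_sub_two_nonneg {m : ℕ} (hm : 1 ≤ m) : 0 ≤ ((m : ℝ) - 1) * (m - 2) := by
  rcases hm.eq_or_lt with rfl | hlt
  · norm_num
  · have h2 : (2 : ℝ) ≤ m := mod_cast hlt
    nlinarith

theorem two_le_of_mem_replicate {α : Type*} {k m : ℕ} {x y : α}
    (hx : x ∈ Multiset.replicate (k * (m - 1)) y) : (2 : ℝ) ≤ m := by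
  have hne := (Multiset.mem_replicate.1 hx).1
  have two_le : 2 ≤ m := by
    by_contra! hlt
    exact hne (by rw [Nat.sub_eq_zero_of_le (by lia), mul_zero])
  exact mod_cast two_le

/-- `Γ` has the same common neighborhood spectra as the disjoint union of one clique with `a`
vertices and `r` cliques with `b` vertices each. -/
def HasCliqueUnionSpectrum {V : Type*} [Fintype V] [DecidableEq V] (Γ : SimpleGraph V)
    (a r b : ℕ) : Prop :=
  ∀ c, cnPencilSpec Γ c = cnPencilSpec (SimpleGraph.completeGraph (Fin a)) c +
    r • cnPencilSpec (SimpleGraph.completeGraph (Fin b)) c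

namespace HasCliqueUnionSpectrum

variable {V : Type*} [Fintype V] [DecidableEq V] {Γ : SimpleGraph V} {a r b : ℕ}

theorem of_iso_sum
    (e : Γ ≃g SimpleGraph.completeGraph (Fin a) ⊕g SimpleGraph.completeGraph (Fin b)) :
    HasCliqueUnionSpectrum Γ a 1 b := fun c => by
  rw [cnPencilSpec_congr e, cnPencilSpec_sum, one_nsmul]

theorem of_iso_sum_sum
    (e : Γ ≃g SimpleGraph.completeGraph (Fin a) ⊕g
      (SimpleGraph.completeGraph (Fin b) ⊕g SimpleGraph.completeGraph (Fin b))) :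
    HasCliqueUnionSpectrum Γ a 2 b := fun c => by
  rw [cnPencilSpec_congr e, cnPencilSpec_sum, cnPencilSpec_sum, two_nsmul]

theorem cnPencilSpec_eq (h : HasCliqueUnionSpectrum Γ a r b) (ha : 1 ≤ a) (hb : 1 ≤ b) (c : ℝ) :
    cnPencilSpec Γ c =
      ({(1 + c) * ((a : ℝ) - 1) * (a - 2)} +
        Multiset.replicate (a - 1) (((a : ℝ) - 2) * (a - 1 - c))) +
      (Multiset.replicate r ((1 + c) * ((b : ℝ) - 1) * (b - 2)) +
        Multiset.replicate (r * (b - 1)) (((b : ℝ) - 2) * (b - 1 - c))) := by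
  have : NeZero a := ⟨by lia⟩
  have : NeZero b := ⟨by lia⟩
  rw [h c, cnPencilSpec_completeGraph, cnPencilSpec_completeGraph, nsmul_add,
    Multiset.nsmul_singleton, Multiset.nsmul_replicate, Fintype.card_fin, Fintype.card_fin]

theorem cnlSpec_eq (h : HasCliqueUnionSpectrum Γ a r b) (ha : 1 ≤ a) (hb : 1 ≤ b) :
    cnlSpec Γ = Multiset.replicate (1 + r) 0 + Multiset.replicate (a - 1) ((a : ℝ) * (a - 2)) +
      Multiset.replicate (r * (b - 1)) ((b : ℝ) * (b - 2)) := by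
  rw [cnlSpec_eq_cnPencilSpec, h.cnPencilSpec_eq ha hb, Multiset.replicate_add,
    Multiset.replicate_one]
  ring_nf
  abel

theorem cnslSpec_eq (h : HasCliqueUnionSpectrum Γ a r b) (ha : 1 ≤ a) (hb : 1 ≤ b) :
    cnslSpec Γ = Multiset.replicate 1 (2 * ((a : ℝ) - 1) * (a - 2)) +
      Multiset.replicate (a - 1) (((a : ℝ) - 2) ^ 2) +
      Multiset.replicate r (2 * ((b : ℝ) - 1) * (b - 2)) +
      Multiset.replicate (r * (b - 1)) (((b : ℝ) - 2) ^ 2) := by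
  rw [cnslSpec_eq_cnPencilSpec, h.cnPencilSpec_eq ha hb, Multiset.replicate_one, one_add_one_eq_two,
    sub_sub _ 1 1, sub_sub _ 1 1, one_add_one_eq_two, ← sq, ← sq, ← add_assoc]

theorem add_mul_cnDelta (h : HasCliqueUnionSpectrum Γ a r b) (ha : 1 ≤ a) (hb : 1 ≤ b) :
    ((a : ℝ) + r * b) * cnDelta Γ =
      a * ((a - 1) * (a - 2)) + r * b * ((b - 1) * (b - 2)) := by
  have card_eq : Fintype.card V = a + r * b := by
    rw [← card_cnPencilSpec Γ 0, h 0]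
    simp [card_cnPencilSpec]
  have total := sum_cnPencilSpec Γ 0
  rw [h.cnPencilSpec_eq ha hb, card_eq] at total
  simp only [Multiset.sum_add, Multiset.sum_singleton, Multiset.sum_replicate, nsmul_eq_mul,
    Nat.cast_add, Nat.cast_mul, Nat.cast_sub ha, Nat.cast_sub hb, Nat.cast_one] at total
  linear_combination -total

theorem cnDelta_le (h : HasCliqueUnionSpectrum Γ a r b) (hb : 1 ≤ b) (hab : b ≤ a) :
    cnDelta Γ ≤ ((a : ℝ) - 1) * (a - 2) := by
  have ha : 1 ≤ a := hb.trans hab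
  have row_sum_le : ((b : ℝ) - 1) * (b - 2) ≤ (a - 1) * (a - 2) := by
    rcases hab.eq_or_lt with rfl | hlt
    · rfl
    · have h1 : (b : ℝ) + 1 ≤ a := mod_cast hlt
      have h2 : (1 : ℝ) ≤ b := mod_cast hb
      nlinarith
  have hpos : (0 : ℝ) < a + r * b := by positivity
  refine le_of_mul_le_mul_left ?_ hpos
  rw [h.add_mul_cnDelta ha hb, add_mul]
  gcongr

theorem two_mul_le_cnDelta (h : HasCliqueUnionSpectrum Γ a r b) (hb : 1 ≤ b) (hab : 2 * b ≤ a)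
    (hrb : r * b ≤ a) : 2 * ((b : ℝ) - 1) * (b - 2) ≤ cnDelta Γ := by
  have three_mul_le : 3 * (((b : ℝ) - 1) * (b - 2)) ≤ (a - 1) * (a - 2) := by
    have h1 : (2 : ℝ) * b ≤ a := mod_cast hab
    have h2 : (1 : ℝ) ≤ b := mod_cast hb
    nlinarith
  have rb_le : (r : ℝ) * b ≤ a := mod_cast hrb
  have hpos : (0 : ℝ) < a + r * b := by
    have : 0 < a := by lia
    positivity
  refine le_of_mul_le_mul_left ?_ hpos
  rw [h.add_mul_cnDelta (by lia) hb]
  nlinarith [mul_le_mul_of_nonneg_right rb_le (sub_one_mul_sub_two_nonneg hb),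
    mul_le_mul_of_nonneg_left three_mul_le (Nat.cast_nonneg (α := ℝ) a)]

theorem cnlEnergy_eq (h : HasCliqueUnionSpectrum Γ a r b) (hb : 1 ≤ b) (hab : 2 * b ≤ a)
    (hrb : r * b ≤ a) :
    cnlEnergy Γ = 2 * ((a : ℝ) - 1) * (a * (a - 2) - cnDelta Γ) := by
  have spec : cnPencilSpec Γ (-1) = Multiset.replicate (a - 1) ((a : ℝ) * (a - 2)) +
      (Multiset.replicate (1 + r) 0 + Multiset.replicate (r * (b - 1)) ((b : ℝ) * (b - 2))) := by
    rw [← cnlSpec_eq_cnPencilSpec, h.cnlSpec_eq (by lia) hb,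
      add_comm (Multiset.replicate (1 + r) 0), add_assoc]
  have two_le : (2 : ℝ) ≤ a := mod_cast (by lia : 2 ≤ a)
  have upper := h.cnDelta_le hb (by lia)
  have lower := h.two_mul_le_cnDelta hb hab hrb
  have hb0 := sub_one_mul_sub_two_nonneg hb
  rw [cnlEnergy, cnlSpec_eq_cnPencilSpec, sum_abs_sub_cnDelta spec]
  · simp only [Multiset.map_replicate, Multiset.sum_replicate, nsmul_eq_mul]
    rw [Nat.cast_sub (by lia), Nat.cast_one, mul_assoc]
  · intro x hx
    rw [Multiset.eq_of_mem_replicate hx]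
    nlinarith
  · intro x hx
    rcases Multiset.mem_add.1 hx with hx | hx <;> rw [Multiset.eq_of_mem_replicate hx]
    · linarith
    · nlinarith [sq_nonneg ((b : ℝ) - 2)]

theorem le_cnDelta_of_mem_small (h : HasCliqueUnionSpectrum Γ a r b) (hb : 1 ≤ b)
    (hab : 2 * b ≤ a) (hrb : r * b ≤ a) :
    ∀ x ∈ Multiset.replicate r (2 * ((b : ℝ) - 1) * (b - 2)) +
      Multiset.replicate (r * (b - 1)) (((b : ℝ) - 2) ^ 2), x ≤ cnDelta Γ := by
  have lower := h.two_mul_le_cnDelta hb hab hrb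
  intro x hx
  rcases Multiset.mem_add.1 hx with hx | hx <;> rw [Multiset.eq_of_mem_replicate hx]
  · exact lower
  · have two_le := two_le_of_mem_replicate hx
    nlinarith

theorem cnslEnergy_eq_of_cnDelta_le (h : HasCliqueUnionSpectrum Γ a r b) (hb : 1 ≤ b)
    (hab : 2 * b ≤ a) (hrb : r * b ≤ a) (hΔ : cnDelta Γ ≤ ((a : ℝ) - 2) ^ 2) :
    cnslEnergy Γ = 2 * a * ((a - 1) * (a - 2) - cnDelta Γ) := by
  have spec := (cnslSpec_eq_cnPencilSpec Γ).symm.trans (h.cnslSpec_eq (by lia) hb)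
  rw [add_assoc (_ + _)] at spec
  have upper := h.cnDelta_le hb (by lia)
  have ha0 := sub_one_mul_sub_two_nonneg (m := a) (by lia)
  rw [cnslEnergy, cnslSpec_eq_cnPencilSpec,
    sum_abs_sub_cnDelta spec _ (h.le_cnDelta_of_mem_small hb hab hrb)]
  · simp only [Multiset.map_add, Multiset.map_replicate, Multiset.sum_add, Multiset.sum_replicate,
      nsmul_eq_mul]
    rw [Nat.cast_sub (by lia)]
    push_cast
    ring
  · intro x hx
    rcases Multiset.mem_add.1 hx with hx | hx <;> rw [Multiset.eq_of_mem_replicate hx]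
    · linarith
    · exact hΔ

theorem cnslEnergy_eq_of_le_cnDelta (h : HasCliqueUnionSpectrum Γ a r b) (hb : 1 ≤ b)
    (hab : 2 * b ≤ a) (hrb : r * b ≤ a) (hΔ : ((a : ℝ) - 2) ^ 2 ≤ cnDelta Γ) :
    cnslEnergy Γ = 2 * (2 * ((a - 1) * (a - 2)) - cnDelta Γ) := by
  have spec := (cnslSpec_eq_cnPencilSpec Γ).symm.trans (h.cnslSpec_eq (by lia) hb)
  rw [add_assoc (_ + _), add_assoc] at spec
  have upper := h.cnDelta_le hb (by lia)
  have ha0 := sub_one_mul_sub_two_nonneg (m := a) (by lia)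
  rw [cnslEnergy, cnslSpec_eq_cnPencilSpec, sum_abs_sub_cnDelta spec]
  · simp [mul_assoc]
  · intro x hx
    rw [Multiset.eq_of_mem_replicate hx]
    linarith
  · intro x hx
    rcases Multiset.mem_add.1 hx with hx | hx
    · rwa [Multiset.eq_of_mem_replicate hx]
    · exact h.le_cnDelta_of_mem_small hb hab hrb x hx

theorem cnDelta_le_sq (h : HasCliqueUnionSpectrum Γ a r b) (hb : 2 ≤ b) (hab : 2 * b ≤ a)
    (hr : 1 ≤ r) : cnDelta Γ ≤ ((a : ℝ) - 2) ^ 2 := by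
  have two_le_b : (2 : ℝ) ≤ b := mod_cast hb
  have two_mul_le : (2 : ℝ) * b ≤ a := mod_cast hab
  have one_le_r : (1 : ℝ) ≤ r := mod_cast hr
  have gain : (a : ℝ) * (a - 2) ≤ b * ((a - 2) ^ 2 - (b - 1) * (b - 2)) := by
    have product_bound : 2 * ((a : ℝ) - 2) ≤ b * (a - b) := by nlinarith
    nlinarith
  have gain_nonneg : 0 ≤ (b : ℝ) * ((a - 2) ^ 2 - (b - 1) * (b - 2)) :=
    le_trans (by nlinarith) gain
  refine le_of_mul_le_mul_left ?_ (by positivity : (0 : ℝ) < a + r * b)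
  rw [h.add_mul_cnDelta (by lia) (by lia)]
  nlinarith [mul_le_mul_of_nonneg_right one_le_r gain_nonneg]

theorem cnDelta_of_equal_cliques (h : HasCliqueUnionSpectrum Γ b r b) (hb : 1 ≤ b) :
    cnDelta Γ = ((b : ℝ) - 1) * (b - 2) := by
  refine mul_left_cancel₀ (by positivity : (b : ℝ) + r * b ≠ 0) ?_
  rw [h.add_mul_cnDelta hb hb, add_mul]

theorem cnlEnergy_of_equal_cliques (h : HasCliqueUnionSpectrum Γ b r b) (hb : 1 ≤ b) :
    cnlEnergy Γ = 2 * (1 + r) * (((b : ℝ) - 1) * (b - 2)) := by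
  have spec : cnPencilSpec Γ (-1) = Multiset.replicate ((1 + r) * (b - 1)) ((b : ℝ) * (b - 2)) +
      Multiset.replicate (1 + r) 0 := by
    rw [← cnlSpec_eq_cnPencilSpec, h.cnlSpec_eq hb hb, add_mul, one_mul,
      Multiset.replicate_add _ _ (_ * _), add_assoc, add_comm]
  rw [cnlEnergy, cnlSpec_eq_cnPencilSpec, sum_abs_sub_cnDelta spec]
  · simp only [Multiset.map_replicate, Multiset.sum_replicate, nsmul_eq_mul,
      h.cnDelta_of_equal_cliques hb]
    push_cast [Nat.cast_sub hb]
    ring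
  · intro x hx
    have two_le := two_le_of_mem_replicate hx
    rw [Multiset.eq_of_mem_replicate hx, h.cnDelta_of_equal_cliques hb]
    nlinarith
  · intro x hx
    rw [Multiset.eq_of_mem_replicate hx, h.cnDelta_of_equal_cliques hb]
    exact sub_one_mul_sub_two_nonneg hb

theorem cnslEnergy_of_equal_cliques (h : HasCliqueUnionSpectrum Γ b r b) (hb : 1 ≤ b) :
    cnslEnergy Γ = 2 * (1 + r) * (((b : ℝ) - 1) * (b - 2)) := by
  have spec : cnPencilSpec Γ 1 = Multiset.replicate (1 + r) (2 * ((b : ℝ) - 1) * (b - 2)) +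
      Multiset.replicate ((1 + r) * (b - 1)) (((b : ℝ) - 2) ^ 2) := by
    rw [← cnslSpec_eq_cnPencilSpec, h.cnslSpec_eq hb hb, add_mul, one_mul, Multiset.replicate_add,
      Multiset.replicate_add]
    abel
  have nonneg := sub_one_mul_sub_two_nonneg hb
  rw [cnslEnergy, cnslSpec_eq_cnPencilSpec, sum_abs_sub_cnDelta spec]
  · simp only [Multiset.map_replicate, Multiset.sum_replicate, nsmul_eq_mul,
      h.cnDelta_of_equal_cliques hb]
    push_cast
    ring
  · intro x hx
    rw [Multiset.eq_of_mem_replicate hx, h.cnDelta_of_equal_cliques hb]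
    linarith
  · intro x hx
    have two_le := two_le_of_mem_replicate hx
    rw [Multiset.eq_of_mem_replicate hx, h.cnDelta_of_equal_cliques hb]
    nlinarith

end HasCliqueUnionSpectrum

end CliqueUnion

section CentralQuotientParameters

variable {n z : ℕ}

theorem half_sub_eq : (n * z - z - 2) / 2 = (n - 1) * z / 2 - 1 := by
  rw [Nat.sub_one_mul]
  lia

theorem cast_half {m : ℕ} (hm : 2 ∣ m) : ((m / 2 : ℕ) : ℝ) = m / 2 :=
  Nat.cast_div_charZero hm

theorem cast_half_sub_one_mul (hn : 1 ≤ n) (h : 2 ∣ (n - 1) * z) :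
    (((n - 1) * z / 2 : ℕ) : ℝ) = ((n : ℝ) - 1) * z / 2 := by
  rw [cast_half h, Nat.cast_mul, Nat.cast_sub hn, Nat.cast_one]

theorem le_half_sub_one_mul {k m : ℕ} (hn : m < n) (hk : 2 * k ≤ m * z) : k ≤ (n - 1) * z / 2 := by
  have := Nat.mul_le_mul_right z (Nat.le_sub_one_of_lt hn)
  lia

variable {V : Type*} [Fintype V] [DecidableEq V] {Γ : SimpleGraph V}

section Even

variable (h : HasCliqueUnionSpectrum Γ ((n - 1) * z / 2) 2 (z / 2))
include h

theorem cnlSpec_of_even (hn : 2 ≤ n) (hz : 2 ∣ z) (hz0 : 1 ≤ z) :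
    cnlSpec Γ = Multiset.replicate 3 0 +
      Multiset.replicate ((n * z - z - 2) / 2)
        (1 / 4 * ((n : ℝ) * z - z) * ((n : ℝ) * z - z - 4)) +
      Multiset.replicate (z - 2) (1 / 4 * (z : ℝ) * ((z : ℝ) - 4)) := by
  have small : 1 ≤ z / 2 := by lia
  have large : 1 ≤ (n - 1) * z / 2 := small.trans (le_half_sub_one_mul (m := 1) hn (by lia))
  rw [h.cnlSpec_eq large small, half_sub_eq, cast_half hz,
    cast_half_sub_one_mul (by lia) (hz.mul_left _), show 2 * (z / 2 - 1) = z - 2 by lia]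
  congr 2
  · congr 1; ring
  · ring

theorem cnslSpec_of_even (hn : 2 ≤ n) (hz : 2 ∣ z) (hz0 : 1 ≤ z) :
    cnslSpec Γ =
      Multiset.replicate 1 (1 / 2 * ((n : ℝ) * z - z - 2) * ((n : ℝ) * z - z - 4)) +
      Multiset.replicate ((n * z - z - 2) / 2) (1 / 4 * ((n : ℝ) * z - z - 4) ^ 2) +
      Multiset.replicate 2 (1 / 2 * ((z : ℝ) - 2) * ((z : ℝ) - 4)) +
      Multiset.replicate (z - 2) (1 / 4 * ((z : ℝ) - 4) ^ 2) := by
  have small : 1 ≤ z / 2 := by lia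
  have large : 1 ≤ (n - 1) * z / 2 := small.trans (le_half_sub_one_mul (m := 1) hn (by lia))
  rw [h.cnslSpec_eq large small, half_sub_eq, cast_half hz,
    cast_half_sub_one_mul (by lia) (hz.mul_left _), show 2 * (z / 2 - 1) = z - 2 by lia]
  congr 2
  · congr 2 <;> ring
  · congr 1; ring
  · ring

theorem cnDelta_of_even (hn : 2 ≤ n) (hz : 2 ∣ z) (hz0 : 1 ≤ z) :
    cnDelta Γ = (((n : ℝ) - 1) * ((n - 1) * z - 2) * ((n - 1) * z - 4) + 2 * (z - 2) * (z - 4)) /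
      (4 * (n + 1)) := by
  have small : 1 ≤ z / 2 := by lia
  have large : 1 ≤ (n - 1) * z / 2 := small.trans (le_half_sub_one_mul (m := 1) hn (by lia))
  have total := h.add_mul_cnDelta large small
  rw [cast_half hz, cast_half_sub_one_mul (by lia) (hz.mul_left _)] at total
  have hz' : (z : ℝ) ≠ 0 := mod_cast (by lia : z ≠ 0)
  rw [eq_div_iff (by positivity)]
  refine mul_left_cancel₀ hz' ?_
  push_cast at total
  linear_combination 8 * total

theorem cnlEnergy_of_even (hn : 4 ≤ n) (hz : 2 ∣ z) (hz0 : 1 ≤ z) :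
    cnlEnergy Γ =
      (((n : ℝ) - 1) * z - 2) * ((n : ℝ) * ((z : ℝ) + 1) * (((n : ℝ) - 2) * z - 4) + 11 * z - 4) /
        (2 * ((n : ℝ) + 1)) := by
  have large : z ≤ (n - 1) * z / 2 := le_half_sub_one_mul (m := 3) hn (by lia)
  rw [h.cnlEnergy_eq (by lia) (by lia) (by lia), cnDelta_of_even h (by lia) hz hz0,
    cast_half_sub_one_mul (by lia) (hz.mul_left _)]
  field

theorem cnDelta_le_sq_of_even (hn : 4 ≤ n) (hz : 2 ∣ z) (hz0 : 1 ≤ z) (hnz : ¬(n = 4 ∧ z = 2)) :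
    cnDelta Γ ≤ ((((n - 1) * z / 2 : ℕ) : ℝ) - 2) ^ 2 := by
  have large : z ≤ (n - 1) * z / 2 := le_half_sub_one_mul (m := 3) hn (by lia)
  rcases (show 1 ≤ z / 2 by lia).eq_or_lt with hb | hb
  · have hn5 : (5 : ℝ) ≤ n := mod_cast (by lia : 5 ≤ n)
    obtain rfl : z = 2 := by lia
    rw [cnDelta_of_even h (by lia) hz hz0, cast_half_sub_one_mul (by lia) (hz.mul_left _),
      div_le_iff₀ (by positivity)]
    push_cast
    nlinarith
  · exact h.cnDelta_le_sq hb (by lia) one_le_two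

theorem cnslEnergy_of_even (hn : 4 ≤ n) (hz : 2 ∣ z) (hz0 : 1 ≤ z) :
    cnslEnergy Γ =
      (if n = 4 ∧ z = 2 then 28 / 5
      else if n = 4 ∧ 3 ≤ z then 3 / 5 * (z : ℝ) ^ 2 * (4 * (z : ℝ) - 6)
      else ((n : ℝ) - 2) * ((n : ℝ) - 1) * (z : ℝ) ^ 2 * ((n : ℝ) * z - 6) /
        (2 * ((n : ℝ) + 1))) := by
  have large : z ≤ (n - 1) * z / 2 := le_half_sub_one_mul (m := 3) hn (by lia)
  have mean_eq := cnDelta_of_even h (by lia) hz hz0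
  have size_eq := cast_half_sub_one_mul (n := n) (by lia) (hz.mul_left (n - 1))
  by_cases hnz : n = 4 ∧ z = 2
  · obtain ⟨rfl, rfl⟩ := hnz
    rw [h.cnslEnergy_eq_of_le_cnDelta (by lia) (by lia) (by lia) (by rw [mean_eq]; norm_num),
      mean_eq]
    norm_num
  · rw [h.cnslEnergy_eq_of_cnDelta_le (by lia) (by lia) (by lia)
      (cnDelta_le_sq_of_even h hn hz hz0 hnz), mean_eq, size_eq, if_neg hnz]
    split_ifs with hn4
    · rw [hn4.1]
      push_cast
      ring
    · field

end Even

section Odd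

variable (h : HasCliqueUnionSpectrum Γ ((n - 1) * z / 2) 1 z)
include h

theorem cnlSpec_of_odd (hn : 3 ≤ n) (hodd : Odd n) (hz0 : 1 ≤ z) :
    cnlSpec Γ = Multiset.replicate 2 0 +
      Multiset.replicate ((n * z - z - 2) / 2)
        (1 / 4 * ((n : ℝ) * z - z) * ((n : ℝ) * z - z - 4)) +
      Multiset.replicate (z - 1) ((z : ℝ) * ((z : ℝ) - 2)) := by
  have large : 1 ≤ (n - 1) * z / 2 := hz0.trans (le_half_sub_one_mul hn le_rfl)
  rw [h.cnlSpec_eq large hz0, half_sub_eq,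
    cast_half_sub_one_mul (by lia) ((hodd.tsub_odd odd_one).two_dvd.mul_right _), one_mul]
  congr 3; ring

theorem cnslSpec_of_odd (hn : 3 ≤ n) (hodd : Odd n) (hz0 : 1 ≤ z) :
    cnslSpec Γ =
      Multiset.replicate 1 (1 / 2 * ((n : ℝ) * z - z - 2) * ((n : ℝ) * z - z - 4)) +
      Multiset.replicate ((n * z - z - 2) / 2) (1 / 4 * ((n : ℝ) * z - z - 4) ^ 2) +
      Multiset.replicate 1 (2 * ((z : ℝ) - 1) * ((z : ℝ) - 2)) +
      Multiset.replicate (z - 1) (((z : ℝ) - 2) ^ 2) := by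
  have large : 1 ≤ (n - 1) * z / 2 := hz0.trans (le_half_sub_one_mul hn le_rfl)
  rw [h.cnslSpec_eq large hz0, half_sub_eq,
    cast_half_sub_one_mul (by lia) ((hodd.tsub_odd odd_one).two_dvd.mul_right _), one_mul]
  congr 3 <;> congr 1 <;> ring

theorem cnDelta_of_odd (hn : 3 ≤ n) (hodd : Odd n) (hz0 : 1 ≤ z) :
    cnDelta Γ = (((n : ℝ) - 1) * ((n - 1) * z - 2) * ((n - 1) * z - 4) + 8 * (z - 1) * (z - 2)) /
      (4 * (n + 1)) := by
  have large : 1 ≤ (n - 1) * z / 2 := hz0.trans (le_half_sub_one_mul hn le_rfl)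
  have total := h.add_mul_cnDelta large hz0
  rw [cast_half_sub_one_mul (by lia) ((hodd.tsub_odd odd_one).two_dvd.mul_right _)] at total
  have hz' : (z : ℝ) ≠ 0 := mod_cast (by lia : z ≠ 0)
  rw [eq_div_iff (by positivity)]
  refine mul_left_cancel₀ hz' ?_
  push_cast at total
  linear_combination 8 * total

theorem cnlEnergy_of_odd_of_five_le (hn : 5 ≤ n) (hodd : Odd n) (hz0 : 1 ≤ z) :
    cnlEnergy Γ =
      (((n : ℝ) - 1) * z - 2) *
          (((n : ℝ) - 3) * ((n : ℝ) + 1) * (z : ℝ) ^ 2 + (((n : ℝ) - 6) * n + 17) * z -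
            4 * ((n : ℝ) + 1)) /
        (2 * ((n : ℝ) + 1)) := by
  have large : 2 * z ≤ (n - 1) * z / 2 := le_half_sub_one_mul (m := 4) hn (by lia)
  rw [h.cnlEnergy_eq hz0 large (by lia), cnDelta_of_odd h (by lia) hodd hz0,
    cast_half_sub_one_mul (by lia) ((hodd.tsub_odd odd_one).two_dvd.mul_right _)]
  field

theorem cnslEnergy_of_odd_of_five_le (hn : 5 ≤ n) (hodd : Odd n) (hz : 2 ≤ z) :
    cnslEnergy Γ =
      ((n : ℝ) - 3) * ((n : ℝ) - 1) * (z : ℝ) ^ 2 * ((n : ℝ) * z + z - 6) /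
        (2 * ((n : ℝ) + 1)) := by
  have large : 2 * z ≤ (n - 1) * z / 2 := le_half_sub_one_mul (m := 4) hn (by lia)
  rw [h.cnslEnergy_eq_of_cnDelta_le (by lia) large (by lia) (h.cnDelta_le_sq hz large le_rfl),
    cnDelta_of_odd h (by lia) hodd (by lia),
    cast_half_sub_one_mul (by lia) ((hodd.tsub_odd odd_one).two_dvd.mul_right _)]
  field

theorem cnslEnergy_of_odd_of_center_trivial (hn : 5 ≤ n) (hodd : Odd n) (hz : z = 1) :
    cnslEnergy Γ = ((n : ℝ) - 5) * ((n : ℝ) - 3) * ((n : ℝ) + 3) / (2 * ((n : ℝ) + 1)) := by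
  subst hz
  have large : 2 * 1 ≤ (n - 1) * 1 / 2 := le_half_sub_one_mul (m := 4) hn le_rfl
  have mean_eq := cnDelta_of_odd h (by lia) hodd le_rfl
  have size_eq := cast_half_sub_one_mul (n := n) (by lia)
    ((hodd.tsub_odd odd_one).two_dvd.mul_right 1)
  have hn5 : (5 : ℝ) ≤ n := mod_cast hn
  have large_sq_le : ((((n - 1) * 1 / 2 : ℕ) : ℝ) - 2) ^ 2 ≤ cnDelta Γ := by
    rw [mean_eq, size_eq, le_div_iff₀ (by positivity)]
    push_cast
    nlinarith
  rw [h.cnslEnergy_eq_of_le_cnDelta le_rfl large (by lia) large_sq_le, mean_eq, size_eq]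
  push_cast
  field

end Odd

theorem cnlEnergy_of_three (h : HasCliqueUnionSpectrum Γ ((3 - 1) * z / 2) 1 z) (hz0 : 1 ≤ z) :
    cnlEnergy Γ = 4 * ((z : ℝ) - 1) * ((z : ℝ) - 2) := by
  rw [show (3 - 1) * z / 2 = z by lia] at h
  rw [h.cnlEnergy_of_equal_cliques hz0]
  push_cast
  ring

theorem cnslEnergy_of_three (h : HasCliqueUnionSpectrum Γ ((3 - 1) * z / 2) 1 z) (hz0 : 1 ≤ z) :
    cnslEnergy Γ = 4 * ((z : ℝ) - 1) * ((z : ℝ) - 2) := by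
  rw [show (3 - 1) * z / 2 = z by lia] at h
  rw [h.cnslEnergy_of_equal_cliques hz0]
  push_cast
  ring

theorem cnlEnergy_of_odd (h : HasCliqueUnionSpectrum Γ ((n - 1) * z / 2) 1 z) (hn : 3 ≤ n)
    (hodd : Odd n) (hz0 : 1 ≤ z) :
    cnlEnergy Γ =
      (if n = 3 ∧ z = 1 then 0
      else if n = 3 ∧ 2 ≤ z then 4 * ((z : ℝ) - 1) * ((z : ℝ) - 2)
      else (((n : ℝ) - 1) * z - 2) *
          (((n : ℝ) - 3) * ((n : ℝ) + 1) * (z : ℝ) ^ 2 + (((n : ℝ) - 6) * n + 17) * z -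
            4 * ((n : ℝ) + 1)) /
        (2 * ((n : ℝ) + 1))) := by
  rcases hn.eq_or_lt with rfl | hlt
  · rw [cnlEnergy_of_three h hz0]
    rcases hz0.eq_or_lt with rfl | hz
    · norm_num
    · simp [hz.ne', hz]
  · rw [cnlEnergy_of_odd_of_five_le h (by grind) hodd hz0, if_neg (by lia), if_neg (by lia)]

theorem cnslEnergy_of_odd (h : HasCliqueUnionSpectrum Γ ((n - 1) * z / 2) 1 z) (hn : 3 ≤ n)
    (hodd : Odd n) (hz0 : 1 ≤ z) :
    cnslEnergy Γ =
      (if (n = 3 ∧ z = 1) ∨ (n = 5 ∧ z = 1) then 0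
      else if n = 3 ∧ 2 ≤ z then 4 * ((z : ℝ) - 1) * ((z : ℝ) - 2)
      else if 7 ≤ n ∧ z = 1 then
        ((n : ℝ) - 5) * ((n : ℝ) - 3) * ((n : ℝ) + 3) / (2 * ((n : ℝ) + 1))
      else ((n : ℝ) - 3) * ((n : ℝ) - 1) * (z : ℝ) ^ 2 * ((n : ℝ) * z + z - 6) /
        (2 * ((n : ℝ) + 1))) := by
  rcases hn.eq_or_lt with rfl | hlt
  · rw [cnslEnergy_of_three h hz0]
    rcases hz0.eq_or_lt with rfl | hz
    · norm_num
    · simp [hz.ne', hz]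
  have five_le : 5 ≤ n := by grind
  rcases hz0.eq_or_lt with hz | hz
  · rw [cnslEnergy_of_odd_of_center_trivial h five_le hodd hz.symm]
    rcases five_le.eq_or_lt with rfl | hlt
    · simp [← hz]
    · simp [← hz, hlt.ne', (by lia : n ≠ 3), show 7 ≤ n by grind]
  · rw [cnslEnergy_of_odd_of_five_le h five_le hodd hz, if_neg (by lia), if_neg (by lia),
      if_neg (by lia)]

end CentralQuotientParameters

section AbelianIndexTwo

variable {G : Type*} [Group G] {A : Subgroup G} [IsMulCommutative A] {x y : G}

theorem mem_center_of_commute_of_notMem (hA : A.index = 2) (hx : x ∈ A) (hy : y ∉ A)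
    (h : Commute x y) : x ∈ Subgroup.center G := by
  rw [Subgroup.mem_center_iff]
  intro g
  by_cases hg : g ∈ A
  · exact setLike_mul_comm hg hx
  · have hgy : g * y⁻¹ ∈ A := by
      rw [Subgroup.mul_mem_iff_of_index_two hA, inv_mem_iff]
      exact iff_of_false hg hy
    have comm_gy : Commute (g * y⁻¹) x := setLike_mul_comm hgy hx
    simpa using (comm_gy.mul_left h.symm).eq

theorem mul_inv_mem_center_of_commute (hA : A.index = 2) (hx : x ∉ A) (hy : y ∉ A)
    (h : Commute x y) : x * y⁻¹ ∈ Subgroup.center G := by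
  have hxy : x * y⁻¹ ∈ A := by
    rw [Subgroup.mul_mem_iff_of_index_two hA, inv_mem_iff]
    exact iff_of_false hx hy
  exact mem_center_of_commute_of_notMem hA hxy hy (h.mul_left (Commute.refl y).inv_left)

theorem centralizer_singleton_eq_of_mem (hA : A.index = 2) (hx : x ∈ A)
    (hxc : x ∉ Subgroup.center G) : Subgroup.centralizer {x} = A := by
  ext g
  rw [Subgroup.mem_centralizer_singleton_iff]
  refine ⟨fun h => ?_, fun hg => setLike_mul_comm hg hx⟩
  by_contra hg
  exact hxc (mem_center_of_commute_of_notMem hA hx hg (Commute.symm h))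

theorem index_centralizer_singleton_mul_two (hA : A.index = 2) (hAc : Subgroup.center G ≤ A)
    (hx : x ∉ A) : (Subgroup.centralizer {x}).index * 2 = (Subgroup.center G).index := by
  have inf_eq : A ⊓ Subgroup.centralizer {x} = Subgroup.center G := by
    refine le_antisymm (fun g hg => ?_) (le_inf hAc (Subgroup.center_le_centralizer _))
    exact mem_center_of_commute_of_notMem hA hg.1 hx (Subgroup.mem_centralizer_singleton_iff.1 hg.2)
  have : A.Normal := Subgroup.normal_of_index_eq_two hA
  have relIndex_eq : A.relIndex (Subgroup.centralizer {x}) = 2 := by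
    refine ((Nat.dvd_prime Nat.prime_two).1
      (hA ▸ A.relIndex_dvd_index_of_normal _)).resolve_left fun h => hx ?_
    exact Subgroup.relIndex_eq_one.1 h (Subgroup.mem_centralizer_singleton_iff.2 rfl)
  rw [← Subgroup.relIndex_mul_index (Subgroup.center_le_centralizer {x}), ← inf_eq,
    Subgroup.inf_relIndex_right, relIndex_eq, mul_comm]

theorem ncard_carrier_mk (x : G) :
    (ConjClasses.mk x).carrier.ncard = (Subgroup.centralizer {x}).index := by
  rw [← ConjAct.orbit_eq_carrier_conjClasses, ← MulAction.index_stabilizer,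
    Subgroup.centralizer_eq_comap_stabilizer]
  exact (Subgroup.index_comap_of_surjective _ ConjAct.toConjAct.surjective).symm

theorem isMulCommutative_comap_of_isCyclic {H : Type*} [Group H] {φ : G →* H}
    (hφ : φ.ker ≤ Subgroup.center G) (K : Subgroup H) [IsCyclic K] :
    IsMulCommutative (K.comap φ) := by
  refine MonoidHom.isMulCommutative_of_isCyclic_of_ker_le_center (φ.subgroupComap K) fun a ha => ?_
  have ha_center : (a : G) ∈ Subgroup.center G := hφ (congrArg Subtype.val ha)
  exact Subgroup.mem_center_iff.2 fun b => Subtype.ext (Subgroup.mem_center_iff.1 ha_center b)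

end AbelianIndexTwo

section ClassLabel

open DihedralGroup

variable {n : ℕ}

open Classical in
/-- Labels the rotations by `0`, and the reflections `sr i` by `1` or `2` according to whether `i`
is a multiple of `2` in `ZMod n`. Reflections are conjugate exactly when their labels agree; all
rotations share one label because their preimages in a central extension commute. -/
noncomputable def dihedralLabel : DihedralGroup n → Fin 3
  | r _ => 0
  | sr i => if Even i then 1 else 2

@[simp]
theorem dihedralLabel_r (i : ZMod n) : dihedralLabel (r i) = 0 := rfl

open Classical in
theorem dihedralLabel_sr (i : ZMod n) : dihedralLabel (sr i) = if Even i then 1 else 2 := rfl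

@[simp]
theorem dihedralLabel_sr_eq_one {i : ZMod n} : dihedralLabel (sr i) = 1 ↔ Even i := by
  simp [dihedralLabel_sr]

@[simp]
theorem dihedralLabel_sr_eq_two {i : ZMod n} : dihedralLabel (sr i) = 2 ↔ ¬Even i := by
  simp [dihedralLabel_sr]

@[simp]
theorem dihedralLabel_sr_ne_zero (i : ZMod n) : dihedralLabel (sr i) ≠ 0 := by
  rw [dihedralLabel_sr]
  split_ifs <;> decide

theorem even_or_even_add_one [NeZero n] (i : ZMod n) : Even i ∨ Even (i + 1) := by
  rw [← ZMod.natCast_zmod_val i, ← Nat.cast_succ]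
  exact (Nat.even_or_odd i.val).imp (·.natCast) (·.add_one.natCast)

theorem not_even_add_one_of_even (hn : Even n) {i : ZMod n} (hi : Even i) : ¬Even (i + 1) := by
  intro hi'
  have even_one : Even (1 : ZMod n) := by simpa using hi'.sub hi
  obtain ⟨k, hk⟩ := even_one.map (ZMod.castHom hn.two_dvd (ZMod 2))
  rw [map_one, CharTwo.add_self_eq_zero] at hk
  exact one_ne_zero hk

theorem even_of_odd (hn : Odd n) (i : ZMod n) : Even i := by
  obtain ⟨m, rfl⟩ := hn
  refine ⟨i * (m + 1), ?_⟩
  have two_mul_add_one : (2 * m + 1 : ZMod (2 * m + 1)) = 0 := mod_cast ZMod.natCast_self _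
  linear_combination -i * two_mul_add_one

theorem even_sub_of_dihedralLabel_eq [NeZero n] {i j : ZMod n}
    (h : dihedralLabel (sr i) = dihedralLabel (sr j)) : Even (j - i) := by
  by_cases hi : Even i
  · exact (dihedralLabel_sr_eq_one.1 (h ▸ dihedralLabel_sr_eq_one.2 hi)).sub hi
  · have hj : ¬Even j := dihedralLabel_sr_eq_two.1 (h ▸ dihedralLabel_sr_eq_two.2 hi)
    simpa using ((even_or_even_add_one j).resolve_left hj).sub
      ((even_or_even_add_one i).resolve_left hi)

theorem dihedralLabel_eq_of_isConj {d e : DihedralGroup n} (h : IsConj d e) :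
    dihedralLabel d = dihedralLabel e := by
  have label_sr_add (i : ZMod n) {k : ZMod n} (hk : Even k) :
      dihedralLabel (sr i) = dihedralLabel (sr (i + k)) := by
    have even_iff : Even (i + k) ↔ Even i :=
      ⟨fun h => by simpa using h.sub hk, fun h => h.add hk⟩
    classical
    exact if_congr even_iff.symm rfl rfl
  obtain ⟨c, rfl⟩ := isConj_iff.1 h
  rcases d with i | i <;> rcases c with j | j
  · simp
  · simp
  · convert label_sr_add i (even_neg.2 (Even.add_self j)) using 2
    simp only [r_mul_sr, inv_r, sr_mul_r]
    ring_nf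
  · convert label_sr_add i (Even.add_self (j - i)) using 2
    simp only [sr_mul_sr, inv_sr, r_mul_sr]
    ring_nf

theorem isConj_of_dihedralLabel_eq [NeZero n] {d e : DihedralGroup n} (hd : dihedralLabel d ≠ 0)
    (h : dihedralLabel d = dihedralLabel e) : IsConj d e := by
  rcases d with i | i
  · simp at hd
  rcases e with j | j
  · simp at h
  obtain ⟨k, hk⟩ := even_sub_of_dihedralLabel_eq h
  refine isConj_iff.2 ⟨r (-k), ?_⟩
  simp only [r_mul_sr, inv_r, sr_mul_r]
  congr 1
  linear_combination -hk

theorem mem_zpowers_r_one_iff {d : DihedralGroup n} :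
    d ∈ Subgroup.zpowers (r 1 : DihedralGroup n) ↔ dihedralLabel d = 0 := by
  rw [Subgroup.mem_zpowers_iff]
  rcases d with i | i
  · simpa using ZMod.intCast_surjective i
  · simp

theorem index_zpowers_r_one [NeZero n] :
    (Subgroup.zpowers (r 1 : DihedralGroup n)).index = 2 := by
  have h := (Subgroup.zpowers (r 1 : DihedralGroup n)).index_mul_card
  rw [Nat.card_zpowers, orderOf_r_one, nat_card] at h
  exact Nat.eq_of_mul_eq_mul_right (NeZero.pos n) h

theorem ncard_nontrivial_rotations [NeZero n] :
    {d : DihedralGroup n | d ≠ 1 ∧ dihedralLabel d = 0}.ncard = n - 1 := by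
  have image_eq : {d : DihedralGroup n | d ≠ 1 ∧ dihedralLabel d = 0} = r '' {0}ᶜ := by
    ext (i | i) <;> simp [one_def, -r_zero]
  rw [image_eq, Set.ncard_image_of_injective _ fun i j => r.inj, Set.ncard_compl,
    Set.ncard_singleton, Nat.card_zmod]

theorem two_mul_ncard_even [NeZero n] (hn : Even n) : 2 * {i : ZMod n | Even i}.ncard = n := by
  have compl_eq : {i : ZMod n | Even i}ᶜ = (· + 1) '' {i : ZMod n | Even i} := by
    ext i
    refine ⟨fun hi => ⟨i - 1, ?_, sub_add_cancel i 1⟩, ?_⟩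
    · exact (even_or_even_add_one (i - 1)).resolve_right (by rwa [sub_add_cancel])
    · rintro ⟨j, hj, rfl⟩
      exact not_even_add_one_of_even hn hj
  have total := Set.ncard_add_ncard_compl {i : ZMod n | Even i}
  rwa [compl_eq, Set.ncard_image_of_injective _ (add_left_injective 1), Nat.card_zmod,
    ← two_mul] at total

theorem setOf_dihedralLabel_eq_one :
    {d : DihedralGroup n | d ≠ 1 ∧ dihedralLabel d = 1} = sr '' {i | Even i} := by
  ext (i | i) <;> simp [one_def, -r_zero]

theorem setOf_dihedralLabel_eq_two :
    {d : DihedralGroup n | d ≠ 1 ∧ dihedralLabel d = 2} = sr '' {i | Even i}ᶜ := by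
  ext (i | i) <;> simp [one_def, -r_zero]

end ClassLabel

section QuotientByCenter

variable {G : Type*} [Group G] {n : ℕ} {φ : G →* DihedralGroup n} {x y : G}

theorem index_center_of_ker_eq_center (hφ : Function.Surjective φ)
    (hker : φ.ker = Subgroup.center G) : (Subgroup.center G).index = 2 * n := by
  rw [← hker, Subgroup.index_ker, MonoidHom.range_eq_top_of_surjective φ hφ, Subgroup.card_top,
    DihedralGroup.nat_card]

theorem notMem_center_iff_map_ne_one (hker : φ.ker = Subgroup.center G) :
    x ∉ Subgroup.center G ↔ φ x ≠ 1 := by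
  rw [← hker, MonoidHom.mem_ker]

variable [NeZero n]

theorem index_comap_rotations (hφ : Function.Surjective φ) :
    ((Subgroup.zpowers (DihedralGroup.r 1)).comap φ).index = 2 := by
  rw [Subgroup.index_comap_of_surjective _ hφ, index_zpowers_r_one]

theorem dihedralLabel_map_eq_of_commute (hφ : Function.Surjective φ)
    (hker : φ.ker = Subgroup.center G) (hx : x ∉ Subgroup.center G) (hy : y ∉ Subgroup.center G)
    (h : Commute x y) : dihedralLabel (φ x) = dihedralLabel (φ y) := by
  have := isMulCommutative_comap_of_isCyclic hker.le (Subgroup.zpowers (DihedralGroup.r 1))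
  have hA := index_comap_rotations hφ
  by_cases hxA : dihedralLabel (φ x) = 0 <;> by_cases hyA : dihedralLabel (φ y) = 0
  · rw [hxA, hyA]
  · exact absurd (mem_center_of_commute_of_notMem hA (mem_zpowers_r_one_iff.2 hxA)
      (mt mem_zpowers_r_one_iff.1 hyA) h) hx
  · exact absurd (mem_center_of_commute_of_notMem hA (mem_zpowers_r_one_iff.2 hyA)
      (mt mem_zpowers_r_one_iff.1 hxA) h.symm) hy
  · have hxy := mul_inv_mem_center_of_commute hA (mt mem_zpowers_r_one_iff.1 hxA)
      (mt mem_zpowers_r_one_iff.1 hyA) h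
    rw [← hker, MonoidHom.mem_ker, map_mul, map_inv, mul_inv_eq_one] at hxy
    rw [hxy]

theorem exists_isConj_commute_of_dihedralLabel_map_eq (hφ : Function.Surjective φ)
    (hker : φ.ker = Subgroup.center G) (h : dihedralLabel (φ x) = dihedralLabel (φ y)) :
    ∃ x', IsConj x x' ∧ Commute x' y := by
  by_cases hx : dihedralLabel (φ x) = 0
  · have := isMulCommutative_comap_of_isCyclic hker.le (Subgroup.zpowers (DihedralGroup.r 1))
    have hxA : x ∈ (Subgroup.zpowers (DihedralGroup.r 1)).comap φ := mem_zpowers_r_one_iff.2 hx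
    have hyA : y ∈ (Subgroup.zpowers (DihedralGroup.r 1)).comap φ :=
      mem_zpowers_r_one_iff.2 (h ▸ hx)
    exact ⟨x, IsConj.refl x, setLike_mul_comm hxA hyA⟩
  · obtain ⟨d, hd⟩ := isConj_iff.1 (isConj_of_dihedralLabel_eq hx h)
    obtain ⟨g, rfl⟩ := hφ d
    have central : g * x * g⁻¹ * y⁻¹ ∈ Subgroup.center G := by
      rw [← hker, MonoidHom.mem_ker, map_mul, map_mul, map_mul, map_inv, map_inv, hd,
        mul_inv_cancel]
    have comm_div : Commute (g * x * g⁻¹ * y⁻¹) y := (Subgroup.mem_center_iff.1 central y).symm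
    exact ⟨g * x * g⁻¹, isConj_iff.2 ⟨g, rfl⟩, by simpa using comm_div.mul_left (Commute.refl y)⟩

theorem ncard_carrier_mk_of_dihedralLabel_eq_zero (hφ : Function.Surjective φ)
    (hker : φ.ker = Subgroup.center G) (hx : x ∉ Subgroup.center G)
    (h : dihedralLabel (φ x) = 0) : (ConjClasses.mk x).carrier.ncard = 2 := by
  have := isMulCommutative_comap_of_isCyclic hker.le (Subgroup.zpowers (DihedralGroup.r 1))
  have hA := index_comap_rotations hφ
  rw [ncard_carrier_mk, centralizer_singleton_eq_of_mem hA (mem_zpowers_r_one_iff.2 h) hx, hA]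

theorem ncard_carrier_mk_of_dihedralLabel_ne_zero (hφ : Function.Surjective φ)
    (hker : φ.ker = Subgroup.center G) (h : dihedralLabel (φ x) ≠ 0) :
    (ConjClasses.mk x).carrier.ncard = n := by
  have := isMulCommutative_comap_of_isCyclic hker.le (Subgroup.zpowers (DihedralGroup.r 1))
  have center_le : Subgroup.center G ≤ (Subgroup.zpowers (DihedralGroup.r 1)).comap φ :=
    hker ▸ φ.ker_le_comap _
  have index_mul_two := index_centralizer_singleton_mul_two (index_comap_rotations hφ) center_le
    (mt mem_zpowers_r_one_iff.1 h)
  rw [index_center_of_ker_eq_center hφ hker, mul_comm] at index_mul_two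
  rw [ncard_carrier_mk, Nat.eq_of_mul_eq_mul_left two_pos index_mul_two]

end QuotientByCenter

namespace CCCVertex

variable {G : Type*} [Group G] {n : ℕ}

/-- The common `dihedralLabel` of the images under `φ` of the elements of a class. When `φ` is the
quotient by the center, its fibers are the cliques of the commuting conjugacy class graph. -/
noncomputable def label (φ : G →* DihedralGroup n) (v : CCCVertex G) : Fin 3 :=
  Quotient.lift (fun x => dihedralLabel (φ x))
    (fun _ _ h => dihedralLabel_eq_of_isConj (φ.map_isConj h)) v.1

theorem label_eq_of_mem_carrier (φ : G →* DihedralGroup n) {v : CCCVertex G} {x : G}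
    (hx : x ∈ v.1.carrier) : v.label φ = dihedralLabel (φ x) := by
  rw [label, ← ConjClasses.mem_carrier_iff_mk_eq.1 hx]
  rfl

theorem notMem_center_of_mem_carrier {v : CCCVertex G} {x : G} (hx : x ∈ v.1.carrier) :
    x ∉ Subgroup.center G := by
  obtain ⟨y, hy, hyv⟩ := v.2
  have hxy : IsConj x y := ConjClasses.mk_eq_mk_iff_isConj.1
    ((ConjClasses.mem_carrier_iff_mk_eq.1 hx).trans hyv.symm)
  exact fun hxc => hy (hxy.eq_of_left_mem_center hxc ▸ hxc)

theorem label_ne_two_of_odd {φ : G →* DihedralGroup n} (hn : Odd n) (v : CCCVertex G) :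
    v.label φ ≠ 2 := by
  obtain ⟨x, hx⟩ := ConjClasses.exists_rep v.1
  rw [label_eq_of_mem_carrier φ (ConjClasses.mem_carrier_iff_mk_eq.2 hx)]
  rcases φ x with _ | i
  · simp
  · simpa using even_of_odd hn i

variable [NeZero n] {φ : G →* DihedralGroup n}

theorem cccGraph_adj_iff_label_eq (hφ : Function.Surjective φ) (hker : φ.ker = Subgroup.center G)
    {v w : CCCVertex G} : (cccGraph G).Adj v w ↔ v ≠ w ∧ v.label φ = w.label φ := by
  refine and_congr_right fun _ => ⟨?_, fun h => ?_⟩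
  · rintro ⟨x, hx, y, hy, hxy⟩
    rw [label_eq_of_mem_carrier φ hx, label_eq_of_mem_carrier φ hy]
    exact dihedralLabel_map_eq_of_commute hφ hker (notMem_center_of_mem_carrier hx)
      (notMem_center_of_mem_carrier hy) hxy
  · obtain ⟨x, hx⟩ := ConjClasses.exists_rep v.1
    obtain ⟨y, hy⟩ := ConjClasses.exists_rep w.1
    rw [← ConjClasses.mem_carrier_iff_mk_eq] at hx hy
    rw [label_eq_of_mem_carrier φ hx, label_eq_of_mem_carrier φ hy] at h
    obtain ⟨x', hxx', hx'y⟩ := exists_isConj_commute_of_dihedralLabel_map_eq hφ hker h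
    refine ⟨x', ?_, y, hy, hx'y⟩
    rw [ConjClasses.mem_carrier_iff_mk_eq] at hx ⊢
    rw [← hx, ConjClasses.mk_eq_mk_iff_isConj]
    exact hxx'.symm

end CCCVertex

theorem ncard_preimage_of_ncard_fiber {α β : Type*} [Finite α] [Finite β] {f : α → β} {S : Set β}
    {s : ℕ} (hf : ∀ b ∈ S, (f ⁻¹' {b}).ncard = s) : (f ⁻¹' S).ncard = S.ncard * s := by
  classical
  have := Fintype.ofFinite α
  have := Fintype.ofFinite β
  rw [Set.ncard_eq_toFinset_card', Set.ncard_eq_toFinset_card',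
    Finset.card_eq_sum_card_fiberwise (f := f) (t := S.toFinset) (by simp [Set.MapsTo]),
    Finset.sum_const_nat]
  intro b hb
  rw [← hf b (Set.mem_toFinset.1 hb), Set.ncard_eq_toFinset_card']
  congr 1
  ext a
  simp only [Finset.mem_filter, Set.mem_toFinset, Set.mem_preimage, Set.mem_singleton_iff,
    and_iff_right_iff_imp]
  rintro rfl
  exact Set.mem_toFinset.1 hb

theorem ncard_preimage_singleton_eq_card_ker {G H : Type*} [Group G] [Group H] {φ : G →* H}
    (hφ : Function.Surjective φ) (h : H) : (φ ⁻¹' {h}).ncard = Nat.card φ.ker := by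
  rw [← Nat.card_coe_set_eq]
  exact Nat.card_congr (MonoidHom.fiberEquivKerOfSurjective hφ h)

namespace CCCVertex

variable {G : Type*} [Group G] [Finite G] {n : ℕ} {φ : G →* DihedralGroup n}

/-- Both sides count the non-central elements of `G` lying over the label `k`. -/
theorem ncard_label_eq_mul [NeZero n] (hφ : Function.Surjective φ)
    (hker : φ.ker = Subgroup.center G) {k : Fin 3} {s : ℕ}
    (hs : ∀ x ∉ Subgroup.center G, dihedralLabel (φ x) = k → (ConjClasses.mk x).carrier.ncard = s) :
    {v : CCCVertex G | v.label φ = k}.ncard * s =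
      {d : DihedralGroup n | d ≠ 1 ∧ dihedralLabel d = k}.ncard *
        Nat.card (Subgroup.center G) := by
  have : Finite (ConjClasses G) := Quotient.finite _
  have preimage_eq : φ ⁻¹' {d | d ≠ 1 ∧ dihedralLabel d = k} =
      ConjClasses.mk ⁻¹' (Subtype.val '' {v : CCCVertex G | v.label φ = k}) := by
    ext x
    simp only [Set.mem_preimage, Set.mem_ofPred_eq, Set.mem_image,
      ← notMem_center_iff_map_ne_one hker]
    constructor
    · rintro ⟨hx, hk⟩
      exact ⟨⟨ConjClasses.mk x, x, hx, rfl⟩, hk, rfl⟩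
    · rintro ⟨v, hk, hv⟩
      have hx : x ∈ v.1.carrier := ConjClasses.mem_carrier_iff_mk_eq.2 hv.symm
      exact ⟨notMem_center_of_mem_carrier hx, label_eq_of_mem_carrier φ hx ▸ hk⟩
  have class_size : ∀ c ∈ Subtype.val '' {v : CCCVertex G | v.label φ = k},
      (ConjClasses.mk ⁻¹' {c}).ncard = s := by
    rintro _ ⟨⟨_, x, hx, rfl⟩, hk, rfl⟩
    rw [← hs x hx hk, ConjClasses.carrier_eq_preimage_mk]
  have image_card : (Subtype.val '' {v : CCCVertex G | v.label φ = k}).ncard =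
      {v : CCCVertex G | v.label φ = k}.ncard :=
    Set.ncard_image_of_injective _ Subtype.val_injective
  rw [← image_card, ← ncard_preimage_of_ncard_fiber class_size, ← preimage_eq, ← hker]
  exact ncard_preimage_of_ncard_fiber fun d _ => ncard_preimage_singleton_eq_card_ker hφ d

variable [NeZero n]

theorem ncard_label_eq_zero_mul_two (hφ : Function.Surjective φ)
    (hker : φ.ker = Subgroup.center G) :
    {v : CCCVertex G | v.label φ = 0}.ncard * 2 = (n - 1) * Nat.card (Subgroup.center G) := by
  rw [← ncard_nontrivial_rotations]
  exact ncard_label_eq_mul hφ hker fun _ =>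
    ncard_carrier_mk_of_dihedralLabel_eq_zero hφ hker

theorem ncard_label_eq_mul_of_ne_zero (hφ : Function.Surjective φ)
    (hker : φ.ker = Subgroup.center G) {k : Fin 3} (hk : k ≠ 0) :
    {v : CCCVertex G | v.label φ = k}.ncard * n =
      {d : DihedralGroup n | d ≠ 1 ∧ dihedralLabel d = k}.ncard *
        Nat.card (Subgroup.center G) :=
  ncard_label_eq_mul hφ hker fun _ _ h =>
    ncard_carrier_mk_of_dihedralLabel_ne_zero hφ hker (h ▸ hk)

theorem two_mul_ncard_label_eq_of_even (hn : Even n) (hφ : Function.Surjective φ)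
    (hker : φ.ker = Subgroup.center G) {k : Fin 3} (hk : k ≠ 0) :
    2 * {v : CCCVertex G | v.label φ = k}.ncard = Nat.card (Subgroup.center G) := by
  have reflections : 2 * {d : DihedralGroup n | d ≠ 1 ∧ dihedralLabel d = k}.ncard = n := by
    have evens := two_mul_ncard_even hn
    have total := Set.ncard_add_ncard_compl {i : ZMod n | Even i}
    rw [Nat.card_zmod] at total
    obtain rfl | rfl : k = 1 ∨ k = 2 := by lia
    · rwa [setOf_dihedralLabel_eq_one, Set.ncard_image_of_injective _ fun _ _ =>
        DihedralGroup.sr.inj]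
    · rw [setOf_dihedralLabel_eq_two, Set.ncard_image_of_injective _ fun _ _ =>
        DihedralGroup.sr.inj]
      lia
  refine Nat.eq_of_mul_eq_mul_right (NeZero.pos n) ?_
  rw [mul_assoc, ncard_label_eq_mul_of_ne_zero hφ hker hk, ← mul_assoc, reflections, mul_comm]

theorem ncard_label_eq_one_of_odd (hn : Odd n) (hφ : Function.Surjective φ)
    (hker : φ.ker = Subgroup.center G) :
    {v : CCCVertex G | v.label φ = 1}.ncard = Nat.card (Subgroup.center G) := by
  have all_even : {i : ZMod n | Even i} = Set.univ := Set.eq_univ_of_forall (even_of_odd hn)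
  refine Nat.eq_of_mul_eq_mul_right (NeZero.pos n) ?_
  rw [ncard_label_eq_mul_of_ne_zero hφ hker one_ne_zero, setOf_dihedralLabel_eq_one, all_even,
    Set.ncard_image_of_injective _ fun _ _ => DihedralGroup.sr.inj, Set.ncard_univ, Nat.card_zmod,
    mul_comm]

end CCCVertex

section ClusterGraph

theorem nonempty_iso_of_adj_iff_of_ncard_fiber_eq {V W ι : Type*} [Finite V] [Finite W]
    {Γ : SimpleGraph V} {Δ : SimpleGraph W} {κ : V → ι} {μ : W → ι}
    (hΓ : ∀ v w, Γ.Adj v w ↔ v ≠ w ∧ κ v = κ w) (hΔ : ∀ v w, Δ.Adj v w ↔ v ≠ w ∧ μ v = μ w)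
    (h : ∀ i, {v | κ v = i}.ncard = {w | μ w = i}.ncard) : Nonempty (Γ ≃g Δ) := by
  have fiber_equiv (i : ι) : Nonempty ({v // κ v = i} ≃ {w // μ w = i}) :=
    Finite.card_eq.1 (h i)
  let e : V ≃ W := Equiv.ofFiberEquiv fun i => (fiber_equiv i).some
  have he (v : V) : μ (e v) = κ v := Equiv.ofFiberEquiv_map _ v
  exact ⟨⟨e, by simp [hΓ, hΔ, he]⟩⟩

theorem ncard_setOf_sum {α β : Type*} [Finite α] [Finite β] (p : α ⊕ β → Prop) :
    {x | p x}.ncard = {a | p (.inl a)}.ncard + {b | p (.inr b)}.ncard := by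
  simp only [← Nat.card_coe_set_eq, ← Nat.card_sum]
  exact Nat.card_congr Equiv.subtypeSum

variable {V : Type*} [Finite V] {Γ : SimpleGraph V} {κ : V → Fin 3}

theorem nonempty_iso_sum_of_label (hΓ : ∀ v w, Γ.Adj v w ↔ v ≠ w ∧ κ v = κ w) {a b : ℕ}
    (h₀ : {v | κ v = 0}.ncard = a) (h₁ : {v | κ v = 1}.ncard = b) (h₂ : ∀ v, κ v ≠ 2) :
    Nonempty (Γ ≃g SimpleGraph.completeGraph (Fin a) ⊕g SimpleGraph.completeGraph (Fin b)) := by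
  refine nonempty_iso_of_adj_iff_of_ncard_fiber_eq (μ := Sum.elim (fun _ => 0) (fun _ => 1)) hΓ
    (by simp) fun i => ?_
  rw [ncard_setOf_sum]
  fin_cases i <;> simp [h₀, h₁, h₂]

theorem nonempty_iso_sum_sum_of_label (hΓ : ∀ v w, Γ.Adj v w ↔ v ≠ w ∧ κ v = κ w) {a b : ℕ}
    (h₀ : {v | κ v = 0}.ncard = a) (h₁ : {v | κ v = 1}.ncard = b)
    (h₂ : {v | κ v = 2}.ncard = b) :
    Nonempty (Γ ≃g SimpleGraph.completeGraph (Fin a) ⊕g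
      (SimpleGraph.completeGraph (Fin b) ⊕g SimpleGraph.completeGraph (Fin b))) := by
  refine nonempty_iso_of_adj_iff_of_ncard_fiber_eq
    (μ := Sum.elim (fun _ => 0) (Sum.elim (fun _ => 1) (fun _ => 2))) hΓ (by simp) fun i => ?_
  rw [ncard_setOf_sum, ncard_setOf_sum]
  fin_cases i <;> simp [h₀, h₁, h₂]

end ClusterGraph

section Structure

variable {G : Type*} [Group G] {n : ℕ}

theorem exists_surjective_ker_eq_center (e : G ⧸ Subgroup.center G ≃* DihedralGroup n) :
    ∃ φ : G →* DihedralGroup n, Function.Surjective φ ∧ φ.ker = Subgroup.center G :=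
  ⟨(e : G ⧸ Subgroup.center G →* DihedralGroup n).comp (QuotientGroup.mk' _),
    e.surjective.comp (QuotientGroup.mk'_surjective _), by
      rw [MonoidHom.ker_mulEquiv_comp, QuotientGroup.ker_mk']⟩

variable [Finite G] [NeZero n] {φ : G →* DihedralGroup n}

open CCCVertex

theorem even_card_center_of_even (hn : Even n) (hφ : Function.Surjective φ)
    (hker : φ.ker = Subgroup.center G) : Even (Nat.card (Subgroup.center G)) :=
  even_iff_two_dvd.2 ⟨_, (two_mul_ncard_label_eq_of_even hn hφ hker one_ne_zero).symm⟩

theorem cccGraph_iso_of_even (hn : Even n) (hφ : Function.Surjective φ)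
    (hker : φ.ker = Subgroup.center G) {z : ℕ} (hz : Nat.card (Subgroup.center G) = z) :
    Nonempty (cccGraph G ≃g SimpleGraph.completeGraph (Fin ((n - 1) * z / 2)) ⊕g
      (SimpleGraph.completeGraph (Fin (z / 2)) ⊕g SimpleGraph.completeGraph (Fin (z / 2)))) := by
  have rotations := ncard_label_eq_zero_mul_two hφ hker
  have evens := two_mul_ncard_label_eq_of_even hn hφ hker (k := 1) (by decide)
  have odds := two_mul_ncard_label_eq_of_even hn hφ hker (k := 2) (by decide)
  rw [hz] at rotations evens odds
  exact nonempty_iso_sum_sum_of_label (fun _ _ => cccGraph_adj_iff_label_eq hφ hker)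
    (by lia) (by lia) (by lia)

theorem cccGraph_iso_of_odd (hn : Odd n) (hφ : Function.Surjective φ)
    (hker : φ.ker = Subgroup.center G) {z : ℕ} (hz : Nat.card (Subgroup.center G) = z) :
    Nonempty (cccGraph G ≃g SimpleGraph.completeGraph (Fin ((n - 1) * z / 2)) ⊕g
      SimpleGraph.completeGraph (Fin z)) := by
  have rotations := ncard_label_eq_zero_mul_two hφ hker
  rw [hz] at rotations
  exact nonempty_iso_sum_of_label (fun _ _ => cccGraph_adj_iff_label_eq hφ hker) (by lia)
    ((ncard_label_eq_one_of_odd hn hφ hker).trans hz) (label_ne_two_of_odd hn)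

end Structure

theorem mainTheorem2 (G : Type*) [Group G] [Finite G] (n z : ℕ) (hn : 3 ≤ n)
    (hz : Nat.card (Subgroup.center G) = z)
    (hG : Nonempty (G ⧸ Subgroup.center G ≃* DihedralGroup n)) :
    (Even n →
      -- the structure of the graph
      (Even z ∧
        Nonempty (cccGraph G ≃g
          (SimpleGraph.completeGraph (Fin ((n - 1) * z / 2)) ⊕g
            (SimpleGraph.completeGraph (Fin (z / 2)) ⊕g SimpleGraph.completeGraph (Fin (z / 2)))))) ∧
      -- the Laplacian spectrum and energy
      cnlSpec (cccGraph G) =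
        Multiset.replicate 3 0
          + Multiset.replicate ((n * z - z - 2) / 2)
              (1 / 4 * ((n : ℝ) * z - z) * ((n : ℝ) * z - z - 4))
          + Multiset.replicate (z - 2) (1 / 4 * (z : ℝ) * ((z : ℝ) - 4)) ∧
      cnlEnergy (cccGraph G) =
        (((n : ℝ) - 1) * z - 2) *
            ((n : ℝ) * ((z : ℝ) + 1) * (((n : ℝ) - 2) * z - 4) + 11 * z - 4)
          / (2 * ((n : ℝ) + 1)) ∧
      -- the signless Laplacian spectrum and energy
      cnslSpec (cccGraph G) =
        Multiset.replicate 1 (1 / 2 * ((n : ℝ) * z - z - 2) * ((n : ℝ) * z - z - 4))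
          + Multiset.replicate ((n * z - z - 2) / 2) (1 / 4 * ((n : ℝ) * z - z - 4) ^ 2)
          + Multiset.replicate 2 (1 / 2 * ((z : ℝ) - 2) * ((z : ℝ) - 4))
          + Multiset.replicate (z - 2) (1 / 4 * ((z : ℝ) - 4) ^ 2) ∧
      cnslEnergy (cccGraph G) =
        (if n = 4 ∧ z = 2 then 28 / 5
        else if n = 4 ∧ 3 ≤ z then 3 / 5 * (z : ℝ) ^ 2 * (4 * (z : ℝ) - 6)
        else ((n : ℝ) - 2) * ((n : ℝ) - 1) * (z : ℝ) ^ 2 * ((n : ℝ) * z - 6)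
          / (2 * ((n : ℝ) + 1)))) ∧
    (Odd n →
      -- the structure of the graph
      Nonempty (cccGraph G ≃g
        (SimpleGraph.completeGraph (Fin ((n - 1) * z / 2)) ⊕g SimpleGraph.completeGraph (Fin z))) ∧
      -- the Laplacian spectrum and energy
      cnlSpec (cccGraph G) =
        Multiset.replicate 2 0
          + Multiset.replicate ((n * z - z - 2) / 2)
              (1 / 4 * ((n : ℝ) * z - z) * ((n : ℝ) * z - z - 4))
          + Multiset.replicate (z - 1) ((z : ℝ) * ((z : ℝ) - 2)) ∧
      cnlEnergy (cccGraph G) =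
        (if n = 3 ∧ z = 1 then 0
        else if n = 3 ∧ 2 ≤ z then 4 * ((z : ℝ) - 1) * ((z : ℝ) - 2)
        else (((n : ℝ) - 1) * z - 2) *
            (((n : ℝ) - 3) * ((n : ℝ) + 1) * (z : ℝ) ^ 2
              + (((n : ℝ) - 6) * n + 17) * z - 4 * ((n : ℝ) + 1))
          / (2 * ((n : ℝ) + 1))) ∧
      -- the signless Laplacian spectrum and energy
      cnslSpec (cccGraph G) =
        Multiset.replicate 1 (1 / 2 * ((n : ℝ) * z - z - 2) * ((n : ℝ) * z - z - 4))
          + Multiset.replicate ((n * z - z - 2) / 2) (1 / 4 * ((n : ℝ) * z - z - 4) ^ 2)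
          + Multiset.replicate 1 (2 * ((z : ℝ) - 1) * ((z : ℝ) - 2))
          + Multiset.replicate (z - 1) (((z : ℝ) - 2) ^ 2) ∧
      cnslEnergy (cccGraph G) =
        (if (n = 3 ∧ z = 1) ∨ (n = 5 ∧ z = 1) then 0
        else if n = 3 ∧ 2 ≤ z then 4 * ((z : ℝ) - 1) * ((z : ℝ) - 2)
        else if 7 ≤ n ∧ z = 1 then
          ((n : ℝ) - 5) * ((n : ℝ) - 3) * ((n : ℝ) + 3) / (2 * ((n : ℝ) + 1))
        else ((n : ℝ) - 3) * ((n : ℝ) - 1) * (z : ℝ) ^ 2 * ((n : ℝ) * z + z - 6)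
          / (2 * ((n : ℝ) + 1)))) := by
  obtain ⟨φ, hφ, hker⟩ := exists_surjective_ker_eq_center hG.some
  have : NeZero n := ⟨by lia⟩
  have hz0 : 1 ≤ z := hz ▸ Nat.card_pos
  refine ⟨fun hn_even => ?_, fun hn_odd => ?_⟩
  · have hz_even : Even z := hz ▸ even_card_center_of_even hn_even hφ hker
    have hn4 : 4 ≤ n := by grind
    have hn2 : 2 ≤ n := by lia
    have iso := cccGraph_iso_of_even hn_even hφ hker hz
    have spectrum := HasCliqueUnionSpectrum.of_iso_sum_sum iso.some
    exact ⟨⟨hz_even, iso⟩, cnlSpec_of_even spectrum hn2 hz_even.two_dvd hz0,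
      cnlEnergy_of_even spectrum hn4 hz_even.two_dvd hz0,
      cnslSpec_of_even spectrum hn2 hz_even.two_dvd hz0,
      cnslEnergy_of_even spectrum hn4 hz_even.two_dvd hz0⟩
  · have iso := cccGraph_iso_of_odd hn_odd hφ hker hz
    have spectrum := HasCliqueUnionSpectrum.of_iso_sum iso.some
    exact ⟨iso, cnlSpec_of_odd spectrum hn hn_odd hz0, cnlEnergy_of_odd spectrum hn hn_odd hz0,
      cnslSpec_of_odd spectrum hn hn_odd hz0, cnslEnergy_of_odd spectrum hn hn_odd hz0⟩
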